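/- Let $d_x,d_u\ge 1$ be integers, let $R_x\in\mathbb{R}^{d_x\times d_x}$ be a symmetric matrix with $R_x\succeq I$, and let $R_u=I\in\mathbb{R}^{d_u\times d_u}$. A system is a pair $(A,B)$ with $A\in\mathbb{R}^{d_x\times d_x}$ and $B\in\mathbb{R}^{d_x\times d_u}$. It is stabilizable if there is $K\in\mathbb{R}^{d_u\times d_x}$ such that the spectral radius of $A+BK$ is less than $1$. For a stabilizable system, $P_\infty(A,B)$ denotes the unique positive semidefinite solution $P$ of the discrete algebraic Riccati equation $$P=A^\top PA-A^\top PB\,(R_u+B^\top PB)^{-1}B^\top PA+R_x .$$ Let $\|\cdot\|$ be the spectral (Euclidean operator) norm, put $C_{\mathrm{safe}}(A,B)=54\,\|P_\infty(A,B)\|^5$, and $$\mathcal{B}_{\mathrm{op}}(\epsilon;A_0,B_0)=\{(A,B):\max\{\|A-A_0\|,\|B-B_0\|\}\le\epsilon\}.$$ **Theorem.** Let $(A_0,B_0)$ be stabilizable, and let $(\widehat A,\widehat B)$ and $(A_\star,B_\star)$ be any two systems in $\mathcal{B}_{\mathrm{op}}\bigl(\tfrac{1}{3C_{\mathrm{safe}}(A_0,B_0)};A_0,B_0\bigr)$.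 Then $(\widehat A,\widehat B)$ and $(A_\star,B_\star)$ are stabilizable (so that, as for $(A_0,B_0)$, their Riccati equations have unique positive semidefinite solutions), $$\max\{\|A_\star-\widehat A\|,\|\widehat B-B_\star\|\}\le\frac{1}{C_{\mathrm{safe}}(A_\star,B_\star)},\qquad\text{and}\qquad \|P_\infty(A_\star,B_\star)\|\le 1.0835\,\|P_\infty(A_0,B_0)\|.$$ -/

import Mathlib

open scoped Matrix

-- All matrix norms below are the spectral norm, i.e. the operator norm for Euclidean norms.
open scoped Matrix.Norms.L2Operator

namespace LQR

variable {n m : ℕ}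

/-- A real square matrix is stable if its spectral radius, the largest modulus of a complex
eigenvalue, is smaller than one. -/
def IsStable (M : Matrix (Fin n) (Fin n) ℝ) : Prop :=
  spectralRadius ℂ (M.map (algebraMap ℝ ℂ)) < 1

/-- `(A, B)` is stabilizable if some linear state feedback `K` makes `A + B K` stable. -/
def IsStabilizable (A : Matrix (Fin n) (Fin n) ℝ) (B : Matrix (Fin n) (Fin m) ℝ) : Prop :=
  ∃ K : Matrix (Fin m) (Fin n) ℝ, IsStable (A + B * K)

/-- `P` is a positive semidefinite solution of the discrete algebraic Riccati equation of the
system `(A, B)` with state cost `Rx` and input cost `Ru`. -/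
def IsDARESolution (Rx : Matrix (Fin n) (Fin n) ℝ) (Ru : Matrix (Fin m) (Fin m) ℝ)
    (A : Matrix (Fin n) (Fin n) ℝ) (B : Matrix (Fin n) (Fin m) ℝ)
    (P : Matrix (Fin n) (Fin n) ℝ) : Prop :=
  P.PosSemidef ∧ P = Aᵀ * P * A - Aᵀ * P * B * (Ru + Bᵀ * P * B)⁻¹ * Bᵀ * P * A + Rx

open Classical in
/-- The positive semidefinite solution of the discrete algebraic Riccati equation. It exists and
is unique when `(A, B)` is stabilizable and `Rx`, `Ru` are positive definite; the value `0` is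
used only when there is no such solution. -/
noncomputable def PInfty (Rx : Matrix (Fin n) (Fin n) ℝ) (Ru : Matrix (Fin m) (Fin m) ℝ)
    (A : Matrix (Fin n) (Fin n) ℝ) (B : Matrix (Fin n) (Fin m) ℝ) :
    Matrix (Fin n) (Fin n) ℝ :=
  if h : ∃ P, IsDARESolution Rx Ru A B P then h.choose else 0

/-- The constant `54 ‖P_∞(A, B)‖ ^ 5`. -/
noncomputable def CSafe (Rx : Matrix (Fin n) (Fin n) ℝ) (Ru : Matrix (Fin m) (Fin m) ℝ)
    (A : Matrix (Fin n) (Fin n) ℝ) (B : Matrix (Fin n) (Fin m) ℝ) : ℝ :=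
  54 * ‖PInfty Rx Ru A B‖ ^ 5

/-- The systems `(A, B)` with `‖A - A₀‖ ≤ ε` and `‖B - B₀‖ ≤ ε`. -/
def opBall (ε : ℝ) (A₀ : Matrix (Fin n) (Fin n) ℝ) (B₀ : Matrix (Fin n) (Fin m) ℝ) :
    Set (Matrix (Fin n) (Fin n) ℝ × Matrix (Fin n) (Fin m) ℝ) :=
  {S | max ‖S.1 - A₀‖ ‖S.2 - B₀‖ ≤ ε}

end LQR

namespace LQR

open scoped MatrixOrder
open Matrix Filter Topology

variable {n m : ℕ}

/-! Let `P` solve the Riccati equation of the central system, with optimal gain `K` and closed loop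
`L`. Completing the square (`costStep_eq`) shows that the Riccati map is the Loewner minimum over
feedbacks of the cost step, so `P` is a fixed point of the cost step under `K`.

The same `K` is used on a perturbed system. The closed loop moves by `D` of size at most `2ε√‖P‖`,
which costs at most `0.025 • 1`; since the stage cost `KᵀK + Rx` is at least `1`, scaling `P` by
`1.03` absorbs this (`IsDARESolution.costStep_smul_le`). Thus `1.03 • P` is a supersolution for the
perturbed system. It is a Lyapunov certificate, so `K` still stabilizes, and it bounds value
iteration from `0`, whose limit is a Riccati solution below `1.03 • P` (`exists_isDARESolution_le`).
Uniqueness (`IsDARESolution.unique`) identifies that limit with `PInfty`. The distance bound is then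
the triangle inequality together with `1.0835 ^ 5 ≤ 3 / 2`. -/

/-! ### Loewner order and spectral norm. -/

lemma transpose_mul_mul_mono {P Q : Matrix (Fin n) (Fin n) ℝ} (h : P ≤ Q)
    (L : Matrix (Fin n) (Fin m) ℝ) : Lᵀ * P * L ≤ Lᵀ * Q * L := by
  rw [Matrix.le_iff] at h ⊢
  have := h.conjTranspose_mul_mul_same L
  rwa [conjTranspose_eq_transpose_of_trivial, Matrix.mul_sub, Matrix.sub_mul] at this

lemma transpose_mul_mul_nonneg {P : Matrix (Fin n) (Fin n) ℝ} (h : 0 ≤ P)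
    (L : Matrix (Fin n) (Fin m) ℝ) : 0 ≤ Lᵀ * P * L := by
  simpa using transpose_mul_mul_mono h L

lemma transpose_mul_self_nonneg (L : Matrix (Fin n) (Fin m) ℝ) : 0 ≤ Lᵀ * L := by
  simpa using transpose_mul_mul_nonneg (zero_le_one (α := Matrix (Fin n) (Fin n) ℝ)) L

lemma transpose_eq_of_nonneg {P : Matrix (Fin n) (Fin n) ℝ} (h : 0 ≤ P) : Pᵀ = P := by
  rw [← conjTranspose_eq_transpose_of_trivial]
  exact h.posSemidef.isHermitian

lemma smul_mono_right {P Q : Matrix (Fin n) (Fin n) ℝ} (h : P ≤ Q) {t : ℝ} (ht : 0 ≤ t) :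
    t • P ≤ t • Q := by
  rw [Matrix.le_iff] at h ⊢
  rw [← smul_sub]
  exact h.smul ht

lemma smul_mono_left {P : Matrix (Fin n) (Fin n) ℝ} (h : 0 ≤ P) {s t : ℝ} (hst : s ≤ t) :
    s • P ≤ t • P := by
  rw [Matrix.le_iff, ← sub_smul]
  exact h.posSemidef.smul (sub_nonneg.2 hst)

lemma dotProduct_mulVec_mono {P Q : Matrix (Fin n) (Fin n) ℝ} (h : P ≤ Q) (x : Fin n → ℝ) :
    x ⬝ᵥ P *ᵥ x ≤ x ⬝ᵥ Q *ᵥ x := by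
  have := (Matrix.le_iff.1 h).dotProduct_mulVec_nonneg x
  simpa [sub_mulVec, dotProduct_sub] using this

lemma le_of_forall_dotProduct {P Q : Matrix (Fin n) (Fin n) ℝ} (hP : Pᵀ = P) (hQ : Qᵀ = Q)
    (h : ∀ x : Fin n → ℝ, x ⬝ᵥ P *ᵥ x ≤ x ⬝ᵥ Q *ᵥ x) : P ≤ Q := by
  rw [Matrix.le_iff]
  refine .of_dotProduct_mulVec_nonneg ?_ fun x => ?_
  · rw [IsHermitian, conjTranspose_eq_transpose_of_trivial, transpose_sub, hP, hQ]
  · simpa [sub_mulVec, dotProduct_sub] using h x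

lemma dotProduct_eq_norm_sq (x : Fin n → ℝ) :
    x ⬝ᵥ x = ‖(WithLp.toLp 2 x : EuclideanSpace ℝ (Fin n))‖ ^ 2 := by
  rw [EuclideanSpace.norm_sq_eq]
  simp [dotProduct, sq]

lemma norm_toLp_mulVec_le (M : Matrix (Fin n) (Fin m) ℝ) (x : Fin m → ℝ) :
    ‖(WithLp.toLp 2 (M *ᵥ x) : EuclideanSpace ℝ (Fin n))‖
      ≤ ‖M‖ * ‖(WithLp.toLp 2 x : EuclideanSpace ℝ (Fin m))‖ := by
  simpa using Matrix.l2_opNorm_mulVec M (WithLp.toLp 2 x)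

/-- A symmetric matrix is bounded by its norm in the Loewner order. -/
lemma le_norm_smul_one {P : Matrix (Fin n) (Fin n) ℝ} (hP : Pᵀ = P) : P ≤ ‖P‖ • 1 := by
  refine le_of_forall_dotProduct hP (by simp) fun x => ?_
  have h1 : x ⬝ᵥ P *ᵥ x = inner ℝ (WithLp.toLp 2 (P *ᵥ x) : EuclideanSpace ℝ (Fin n))
      (WithLp.toLp 2 x : EuclideanSpace ℝ (Fin n)) := by
    simp [PiLp.inner_apply, dotProduct]
  have h2 : x ⬝ᵥ (‖P‖ • (1 : Matrix (Fin n) (Fin n) ℝ)) *ᵥ x = ‖P‖ * (x ⬝ᵥ x) := by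
    simp [smul_mulVec]
  rw [h2, h1, dotProduct_eq_norm_sq]
  have h3 := real_inner_le_norm (WithLp.toLp 2 (P *ᵥ x) : EuclideanSpace ℝ (Fin n))
    (WithLp.toLp 2 x : EuclideanSpace ℝ (Fin n))
  have h4 := norm_toLp_mulVec_le P x
  nlinarith [norm_nonneg (WithLp.toLp 2 x : EuclideanSpace ℝ (Fin n))]

lemma norm_sq_le_of_transpose_mul_self_le {M : Matrix (Fin n) (Fin m) ℝ} {c : ℝ} (hc : 0 ≤ c)
    (h : Mᵀ * M ≤ c • 1) : ‖M‖ ^ 2 ≤ c := by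
  have h1 : ‖M‖ ≤ √c := by
    rw [Matrix.l2_opNorm_def]
    refine ContinuousLinearMap.opNorm_le_bound _ (Real.sqrt_nonneg c) fun x => ?_
    rw [← Real.sqrt_sq (norm_nonneg x), ← Real.sqrt_mul hc]
    refine Real.le_sqrt_of_sq_le ?_
    have h2 := dotProduct_mulVec_mono h x.ofLp
    have h3 : x.ofLp ⬝ᵥ (c • (1 : Matrix (Fin m) (Fin m) ℝ)) *ᵥ x.ofLp
        = c * (x.ofLp ⬝ᵥ x.ofLp) := by
      simp [smul_mulVec]
    rw [h3, ← mulVec_mulVec, dotProduct_mulVec, vecMul_transpose, dotProduct_eq_norm_sq,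
      dotProduct_eq_norm_sq] at h2
    exact h2
  calc ‖M‖ ^ 2 ≤ √c ^ 2 := by gcongr
    _ = c := Real.sq_sqrt hc

lemma exists_eq_transpose_mul_self {P : Matrix (Fin n) (Fin n) ℝ} (hP : 0 ≤ P) :
    ∃ Y : Matrix (Fin n) (Fin n) ℝ, P = Yᵀ * Y := by
  obtain ⟨Y, hY⟩ := CStarAlgebra.nonneg_iff_eq_star_mul_self.1 hP
  exact ⟨Y, by rw [hY, star_eq_conjTranspose, conjTranspose_eq_transpose_of_trivial]⟩

lemma norm_le_of_le_smul_one {P : Matrix (Fin n) (Fin n) ℝ} {c : ℝ} (hc : 0 ≤ c) (hP : 0 ≤ P)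
    (h : P ≤ c • 1) : ‖P‖ ≤ c := by
  obtain ⟨Y, rfl⟩ := exists_eq_transpose_mul_self hP
  rw [← conjTranspose_eq_transpose_of_trivial, Matrix.l2_opNorm_conjTranspose_mul_self, ← sq]
  exact norm_sq_le_of_transpose_mul_self_le hc h

lemma norm_mono {P Q : Matrix (Fin n) (Fin n) ℝ} (hP : 0 ≤ P) (h : P ≤ Q) : ‖P‖ ≤ ‖Q‖ :=
  norm_le_of_le_smul_one (norm_nonneg Q) hP
    (h.trans (le_norm_smul_one (transpose_eq_of_nonneg (hP.trans h))))

lemma norm_transpose_eq (M : Matrix (Fin n) (Fin m) ℝ) : ‖Mᵀ‖ = ‖M‖ := by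
  rw [← conjTranspose_eq_transpose_of_trivial, Matrix.l2_opNorm_conjTranspose]

/-! ### The Riccati map as a minimum of cost steps. -/

/-- The right-hand side of the Riccati equation. -/
noncomputable def riccati (Rx : Matrix (Fin n) (Fin n) ℝ)
    (A : Matrix (Fin n) (Fin n) ℝ) (B : Matrix (Fin n) (Fin m) ℝ)
    (P : Matrix (Fin n) (Fin n) ℝ) : Matrix (Fin n) (Fin n) ℝ :=
  Aᵀ * P * A - Aᵀ * P * B * (1 + Bᵀ * P * B)⁻¹ * Bᵀ * P * A + Rx

/-- One step of the cost recursion under the feedback `K`. -/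
def costStep (Rx : Matrix (Fin n) (Fin n) ℝ)
    (A : Matrix (Fin n) (Fin n) ℝ) (B : Matrix (Fin n) (Fin m) ℝ)
    (K : Matrix (Fin m) (Fin n) ℝ) (P : Matrix (Fin n) (Fin n) ℝ) : Matrix (Fin n) (Fin n) ℝ :=
  (A + B * K)ᵀ * P * (A + B * K) + Kᵀ * K + Rx

/-- The feedback that minimizes the one-step cost. -/
noncomputable def gain (A : Matrix (Fin n) (Fin n) ℝ) (B : Matrix (Fin n) (Fin m) ℝ)
    (P : Matrix (Fin n) (Fin n) ℝ) : Matrix (Fin m) (Fin n) ℝ :=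
  -((1 + Bᵀ * P * B)⁻¹ * (Bᵀ * P * A))

variable {Rx : Matrix (Fin n) (Fin n) ℝ} {A : Matrix (Fin n) (Fin n) ℝ}
  {B : Matrix (Fin n) (Fin m) ℝ} {P X : Matrix (Fin n) (Fin n) ℝ}

lemma posDef_one_add (B : Matrix (Fin n) (Fin m) ℝ) (hP : 0 ≤ P) :
    (1 + Bᵀ * P * B).PosDef :=
  PosDef.one.add_posSemidef (transpose_mul_mul_nonneg hP B).posSemidef

/-- Completion of the square in the Riccati equation. -/
lemma costStep_eq (hP : 0 ≤ P) (K : Matrix (Fin m) (Fin n) ℝ) :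
    costStep Rx A B K P = riccati Rx A B P
      + (K - gain A B P)ᵀ * (1 + Bᵀ * P * B) * (K - gain A B P) := by
  have hS := posDef_one_add B hP
  have hdet : IsUnit (1 + Bᵀ * P * B).det := (Matrix.isUnit_iff_isUnit_det _).1 hS.isUnit
  have hPt := transpose_eq_of_nonneg hP
  have hSt : (1 + Bᵀ * P * B)ᵀ = 1 + Bᵀ * P * B := transpose_eq_of_nonneg hS.posSemidef.nonneg
  have hG : (gain A B P)ᵀ = -(Aᵀ * P * B * (1 + Bᵀ * P * B)⁻¹) := by
    rw [gain, transpose_neg, transpose_mul, transpose_nonsing_inv, hSt]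
    simp only [transpose_mul, transpose_transpose, hPt, Matrix.mul_assoc]
  have h1 : (1 + Bᵀ * P * B) * gain A B P = -(Bᵀ * P * A) := by
    rw [gain, Matrix.mul_neg, Matrix.mul_nonsing_inv_cancel_left _ _ hdet]
  have h2 : (gain A B P)ᵀ * (1 + Bᵀ * P * B) = -(Aᵀ * P * B) := by
    rw [hG, Matrix.neg_mul, Matrix.nonsing_inv_mul_cancel_right _ _ hdet]
  have h3 : (K - gain A B P)ᵀ * (1 + Bᵀ * P * B) * (K - gain A B P)
      = Kᵀ * (1 + Bᵀ * P * B) * K + Kᵀ * (Bᵀ * P * A) + Aᵀ * P * B * K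
        + Aᵀ * P * B * (1 + Bᵀ * P * B)⁻¹ * (Bᵀ * P * A) := by
    have h4 : Kᵀ * (1 + Bᵀ * P * B) * gain A B P = -(Kᵀ * (Bᵀ * P * A)) := by
      rw [Matrix.mul_assoc, h1, Matrix.mul_neg]
    rw [transpose_sub, Matrix.sub_mul, Matrix.sub_mul, h2, Matrix.mul_sub, Matrix.mul_sub, h4,
      gain]
    simp only [Matrix.mul_neg, Matrix.neg_mul, Matrix.mul_assoc]
    abel
  rw [h3, costStep, riccati]
  simp only [transpose_add, transpose_mul, Matrix.add_mul, Matrix.mul_add, Matrix.mul_assoc,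
    Matrix.mul_one]
  abel

lemma riccati_le_costStep (hP : 0 ≤ P) (K : Matrix (Fin m) (Fin n) ℝ) :
    riccati Rx A B P ≤ costStep Rx A B K P := by
  rw [costStep_eq hP]
  exact le_add_of_nonneg_right
    (transpose_mul_mul_nonneg (posDef_one_add B hP).posSemidef.nonneg _)

lemma riccati_eq_costStep_gain (hP : 0 ≤ P) :
    riccati Rx A B P = costStep Rx A B (gain A B P) P := by
  rw [costStep_eq hP]; simp

lemma costStep_mono (K : Matrix (Fin m) (Fin n) ℝ) (h : P ≤ X) :
    costStep Rx A B K P ≤ costStep Rx A B K X :=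
  add_le_add_left (add_le_add_left (transpose_mul_mul_mono h _) _) _

/-- The optimal gain for `X` is an admissible competitor for `P`, and each cost step is monotone. -/
lemma riccati_mono (hP : 0 ≤ P) (h : P ≤ X) : riccati Rx A B P ≤ riccati Rx A B X := by
  rw [riccati_eq_costStep_gain (hP.trans h)]
  exact (riccati_le_costStep hP _).trans (costStep_mono _ h)

lemma costStep_nonneg (hRx : 0 ≤ Rx) (hP : 0 ≤ P) (K : Matrix (Fin m) (Fin n) ℝ) :
    0 ≤ costStep Rx A B K P :=
  add_nonneg (add_nonneg (transpose_mul_mul_nonneg hP _) (transpose_mul_self_nonneg K)) hRx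

lemma riccati_nonneg (hRx : 0 ≤ Rx) (hP : 0 ≤ P) : 0 ≤ riccati Rx A B P := by
  rw [riccati_eq_costStep_gain hP]
  exact costStep_nonneg hRx hP _

lemma isDARESolution_iff : IsDARESolution Rx 1 A B P ↔ 0 ≤ P ∧ P = riccati Rx A B P := by
  rw [IsDARESolution, ← Matrix.nonneg_iff_posSemidef, riccati]

/-! ### Existence of Riccati solutions by value iteration. -/

/-- Each quadratic form `x ⬝ᵥ u k *ᵥ x` is a bounded monotone real sequence; polarization recovers
the matrix entries from these. -/
lemma exists_tendsto_of_monotone {u : ℕ → Matrix (Fin n) (Fin n) ℝ} (hu : Monotone u)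
    (h0 : 0 ≤ u 0) (hX : ∀ k, u k ≤ X) :
    ∃ P, Tendsto u atTop (𝓝 P) ∧ 0 ≤ P ∧ P ≤ X := by
  have hsymm : ∀ k, (u k)ᵀ = u k := fun k =>
    transpose_eq_of_nonneg (h0.trans (hu (Nat.zero_le k)))
  have hquad : ∀ x : Fin n → ℝ, ∃ c, Tendsto (fun k => x ⬝ᵥ u k *ᵥ x) atTop (𝓝 c) := fun x =>
    ⟨_, tendsto_atTop_ciSup (fun i j hij => dotProduct_mulVec_mono (hu hij) x)
      ⟨x ⬝ᵥ X *ᵥ x, by rintro _ ⟨k, rfl⟩; exact dotProduct_mulVec_mono (hX k) x⟩⟩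
  choose q hq using hquad
  have hentry : ∀ i j k, u k i j = ((Pi.single i 1 + Pi.single j 1 : Fin n → ℝ) ⬝ᵥ
      u k *ᵥ (Pi.single i 1 + Pi.single j 1) - Pi.single i 1 ⬝ᵥ u k *ᵥ Pi.single i 1
      - Pi.single j 1 ⬝ᵥ u k *ᵥ Pi.single j 1) / 2 := by
    intro i j k
    have : u k j i = u k i j := congrFun (congrFun (hsymm k) i) j
    simp [mulVec_add, add_dotProduct, dotProduct_add, this]
    ring
  refine ⟨Matrix.of fun i j => (q (Pi.single i 1 + Pi.single j 1) - q (Pi.single i 1)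
    - q (Pi.single j 1)) / 2, ?_⟩
  set P : Matrix (Fin n) (Fin n) ℝ := Matrix.of fun i j =>
    (q (Pi.single i 1 + Pi.single j 1) - q (Pi.single i 1) - q (Pi.single j 1)) / 2 with hPdef
  have hlim : Tendsto u atTop (𝓝 P) := by
    refine tendsto_pi_nhds.2 fun i => tendsto_pi_nhds.2 fun j => ?_
    simp_rw [hentry i j]
    exact (((hq _).sub (hq _)).sub (hq _)).div_const 2
  have hPt : Pᵀ = P := by
    have h1 : Tendsto (fun k => (u k)ᵀ) atTop (𝓝 Pᵀ) :=
      (continuous_id.matrix_transpose.tendsto P).comp hlim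
    simp_rw [hsymm] at h1
    exact tendsto_nhds_unique h1 hlim
  have hlimq : ∀ x : Fin n → ℝ, Tendsto (fun k => x ⬝ᵥ u k *ᵥ x) atTop (𝓝 (x ⬝ᵥ P *ᵥ x)) := by
    intro x
    have hc : Continuous fun M : Matrix (Fin n) (Fin n) ℝ => x ⬝ᵥ M *ᵥ x := by fun_prop
    exact (hc.tendsto P).comp hlim
  refine ⟨hlim, ?_, ?_⟩
  · refine le_of_forall_dotProduct (by simp) hPt fun x => ?_
    exact ge_of_tendsto' (hlimq x) fun k =>
      dotProduct_mulVec_mono (h0.trans (hu (Nat.zero_le k))) x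
  · refine le_of_forall_dotProduct hPt
      (transpose_eq_of_nonneg ((h0.trans (hu le_rfl)).trans (hX 0))) fun x => ?_
    exact le_of_tendsto' (hlimq x) fun k => dotProduct_mulVec_mono (hX k) x

lemma tendsto_nonsing_inv {ι : Type*} {F : Filter ι} {u : ι → Matrix (Fin n) (Fin n) ℝ}
    (hP : IsUnit P) (hu : Tendsto u F (𝓝 P)) : Tendsto (fun k => (u k)⁻¹) F (𝓝 P⁻¹) := by
  obtain ⟨U, rfl⟩ := hP
  simp_rw [Matrix.nonsing_inv_eq_ringInverse]
  exact (NormedRing.inverse_continuousAt U).tendsto.comp hu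

lemma tendsto_riccati {u : ℕ → Matrix (Fin n) (Fin n) ℝ} (hP : 0 ≤ P)
    (hu : Tendsto u atTop (𝓝 P)) :
    Tendsto (fun k => riccati Rx A B (u k)) atTop (𝓝 (riccati Rx A B P)) := by
  have h1 : Tendsto (fun k => 1 + Bᵀ * u k * B) atTop (𝓝 (1 + Bᵀ * P * B)) := by
    have hc : Continuous fun M : Matrix (Fin n) (Fin n) ℝ => 1 + Bᵀ * M * B := by fun_prop
    exact (hc.tendsto P).comp hu
  have h2 := tendsto_nonsing_inv (posDef_one_add B hP).isUnit h1
  have hc : Continuous fun M : Matrix (Fin n) (Fin n) ℝ × Matrix (Fin m) (Fin m) ℝ =>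
      Aᵀ * M.1 * A - Aᵀ * M.1 * B * M.2 * Bᵀ * M.1 * A + Rx := by
    have h3 : Continuous fun M : Matrix (Fin n) (Fin n) ℝ × Matrix (Fin m) (Fin m) ℝ =>
      Aᵀ * M.1 := continuous_const.matrix_mul continuous_fst
    exact ((h3.matrix_mul continuous_const).sub
      (((((h3.matrix_mul continuous_const).matrix_mul continuous_snd).matrix_mul
        continuous_const).matrix_mul continuous_fst).matrix_mul continuous_const)).add
          continuous_const
  have h4 := (hc.tendsto (P, (1 + Bᵀ * P * B)⁻¹)).comp (hu.prodMk_nhds h2)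
  simp only [Function.comp_def] at h4
  simpa only [riccati] using h4

/-- A supersolution of the cost recursion dominates a solution of the Riccati equation. -/
lemma exists_isDARESolution_le (hRx : 0 ≤ Rx) (hX : 0 ≤ X) (K : Matrix (Fin m) (Fin n) ℝ)
    (h : costStep Rx A B K X ≤ X) : ∃ P, IsDARESolution Rx 1 A B P ∧ P ≤ X := by
  -- Value iteration from zero increases by monotonicity of the Riccati map and never passes the
  -- supersolution `X`.
  set u : ℕ → Matrix (Fin n) (Fin n) ℝ := fun k => (riccati Rx A B)^[k] 0 with hu
  have hsucc : ∀ k, u (k + 1) = riccati Rx A B (u k) := fun k =>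
    Function.iterate_succ_apply' _ _ _
  have hnonneg : ∀ k, 0 ≤ u k := by
    intro k
    induction k with
    | zero => exact le_rfl
    | succ k ih => rw [hsucc]; exact riccati_nonneg hRx ih
  have hmono : Monotone u := by
    refine monotone_nat_of_le_succ fun k => ?_
    induction k with
    | zero => exact hnonneg 1
    | succ k ih => rw [hsucc, hsucc (k + 1)]; exact riccati_mono (hnonneg k) ih
  have hle : ∀ k, u k ≤ X := by
    intro k
    induction k with
    | zero => exact hX
    | succ k ih =>
      rw [hsucc]
      exact (riccati_le_costStep (hnonneg k) K).trans ((costStep_mono K ih).trans h)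
  obtain ⟨P, hlim, hP0, hPX⟩ := exists_tendsto_of_monotone hmono le_rfl hle
  refine ⟨P, isDARESolution_iff.2 ⟨hP0, ?_⟩, hPX⟩
  have h1 : Tendsto (fun k => u (k + 1)) atTop (𝓝 P) := hlim.comp (tendsto_add_atTop_nat 1)
  simp_rw [hsucc] at h1
  exact tendsto_nhds_unique h1 (tendsto_riccati hP0 hlim)

/-! ### Comparison and uniqueness of Riccati solutions. -/

lemma IsDARESolution.costStep_gain (h : IsDARESolution Rx 1 A B P) :
    costStep Rx A B (gain A B P) P = P := by
  obtain ⟨h0, h1⟩ := isDARESolution_iff.1 h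
  rw [← riccati_eq_costStep_gain h0, ← h1]

lemma IsDARESolution.nonneg (h : IsDARESolution Rx 1 A B P) : 0 ≤ P := h.1.nonneg

lemma IsDARESolution.le_self (h : IsDARESolution Rx 1 A B P) : Rx ≤ P := by
  conv_rhs => rw [← h.costStep_gain]
  exact le_add_of_nonneg_left
    (add_nonneg (transpose_mul_mul_nonneg h.nonneg _) (transpose_mul_self_nonneg _))

/-- The optimal gain for `P` is suboptimal for `X`, so `X - P ≤ Lᵀ(X - P)L`. The map `M ↦ LᵀML`
shrinks `P` by a factor below one, because `LᵀPL ≤ P - 1`; iterating drives the upper bound for `X -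
P` to zero. -/
lemma IsDARESolution.le_of_isDARESolution (hRx : 1 ≤ Rx) (h : IsDARESolution Rx 1 A B P)
    (hX : IsDARESolution Rx 1 A B X) : X ≤ P := by
  have hP1 : 1 ≤ P := hRx.trans h.le_self
  set L := A + B * gain A B P with hL
  have hPL : Lᵀ * P * L ≤ P - 1 := by
    have h1 := h.costStep_gain
    rw [costStep, ← hL] at h1
    rw [le_sub_iff_add_le]
    conv_rhs => rw [← h1]
    exact add_le_add (le_add_of_nonneg_right (transpose_mul_self_nonneg _)) hRx
  have hD : X - P ≤ Lᵀ * (X - P) * L := by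
    have h1 : X ≤ costStep Rx A B (gain A B P) X := by
      conv_lhs => rw [(isDARESolution_iff.1 hX).2]
      exact riccati_le_costStep hX.nonneg _
    have h2 := sub_le_sub_right h1 P
    have h3 : costStep Rx A B (gain A B P) X - P = Lᵀ * (X - P) * L := by
      have h4 := h.costStep_gain
      rw [costStep, ← hL] at h4
      rw [costStep, ← hL, Matrix.mul_sub, Matrix.sub_mul]
      conv_lhs => rhs; rw [← h4]
      abel
    rwa [h3] at h2
  -- The added `1` gives `1 ≤ p` even in dimension zero.
  set p := ‖P‖ + 1 with hp
  have hp1 : 1 ≤ p := by have := norm_nonneg P; linarith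
  have hPp : P ≤ p • 1 := (le_norm_smul_one (transpose_eq_of_nonneg h.nonneg)).trans
    (smul_mono_left zero_le_one (by linarith))
  have hcontr : P - 1 ≤ (1 - 1 / p) • P := by
    have h1 := smul_mono_right hPp (t := 1 / p) (by positivity)
    rw [smul_smul, one_div_mul_cancel (by positivity), one_smul] at h1
    rw [sub_smul, one_smul]
    exact sub_le_sub_left h1 P
  have hq0 : 0 ≤ 1 - 1 / p := by
    rw [sub_nonneg, div_le_one (by positivity)]; exact hp1
  have hq1 : 1 - 1 / p < 1 := by
    have : 0 < 1 / p := by positivity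
    linarith
  have hk : ∀ k : ℕ, X - P ≤ (‖X‖ * (1 - 1 / p) ^ k) • P := by
    intro k
    induction k with
    | zero =>
      rw [pow_zero, mul_one]
      calc X - P ≤ X := sub_le_self _ h.nonneg
        _ ≤ ‖X‖ • 1 := le_norm_smul_one (transpose_eq_of_nonneg hX.nonneg)
        _ ≤ ‖X‖ • P := smul_mono_right hP1 (norm_nonneg X)
    | succ k ih =>
      have ht : 0 ≤ ‖X‖ * (1 - 1 / p) ^ k := by positivity
      calc X - P ≤ Lᵀ * (X - P) * L := hD
        _ ≤ Lᵀ * ((‖X‖ * (1 - 1 / p) ^ k) • P) * L := transpose_mul_mul_mono ih L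
        _ = (‖X‖ * (1 - 1 / p) ^ k) • (Lᵀ * P * L) := by
          rw [Matrix.mul_smul, Matrix.smul_mul]
        _ ≤ (‖X‖ * (1 - 1 / p) ^ k) • ((1 - 1 / p) • P) :=
          smul_mono_right (hPL.trans hcontr) ht
        _ = (‖X‖ * (1 - 1 / p) ^ (k + 1)) • P := by rw [smul_smul, pow_succ, mul_assoc]
  rw [← sub_nonpos]
  refine le_of_forall_dotProduct ?_ (by simp) fun x => ?_
  · rw [transpose_sub, transpose_eq_of_nonneg hX.nonneg, transpose_eq_of_nonneg h.nonneg]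
  · have h1 : Tendsto (fun k : ℕ => (‖X‖ * (1 - 1 / p) ^ k) * (x ⬝ᵥ P *ᵥ x)) atTop
        (𝓝 (‖X‖ * 0 * (x ⬝ᵥ P *ᵥ x))) :=
      ((tendsto_pow_atTop_nhds_zero_of_lt_one hq0 hq1).const_mul _).mul_const _
    have h2 := ge_of_tendsto' h1 fun k => by
      have := dotProduct_mulVec_mono (hk k) x
      rwa [smul_mulVec, dotProduct_smul, smul_eq_mul] at this
    simpa using h2

lemma IsDARESolution.unique (hRx : 1 ≤ Rx) (h : IsDARESolution Rx 1 A B P)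
    (hX : IsDARESolution Rx 1 A B X) : X = P :=
  le_antisymm (h.le_of_isDARESolution hRx hX) (hX.le_of_isDARESolution hRx h)

lemma IsDARESolution.pInfty_eq (hRx : 1 ≤ Rx) (h : IsDARESolution Rx 1 A B P) :
    PInfty Rx 1 A B = P := by
  have hex : ∃ P, IsDARESolution Rx 1 A B P := ⟨P, h⟩
  rw [PInfty, dif_pos hex]
  exact h.unique hRx hex.choose_spec

lemma IsDARESolution.existsUnique (hRx : 1 ≤ Rx) (h : IsDARESolution Rx 1 A B P) :
    ∃! P, IsDARESolution Rx 1 A B P :=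
  ⟨P, h, fun _ hX => h.unique hRx hX⟩

/-! ### Stability and Lyapunov inequalities. -/

/-- A discrete Lyapunov inequality certifies stability. -/
lemma isStable_of_lyapunov {L : Matrix (Fin n) (Fin n) ℝ} (hX : 0 ≤ X)
    (h : Lᵀ * X * L ≤ X - 1) : IsStable L := by
  rw [IsStable]
  rcases isEmpty_or_nonempty (Fin n) with hn | hn
  · rw [spectrum.SpectralRadius.of_subsingleton]; exact zero_lt_one
  · refine spectrum.spectralRadius_lt_of_forall_lt _ (r := 1) fun z hz => ?_
    rw [← Matrix.spectrum_toLin', ← Module.End.hasEigenvalue_iff_mem_spectrum] at hz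
    obtain ⟨v, hv⟩ := hz.exists_hasEigenvector
    have hv1 := hv.apply_eq_smul
    have hv0 := hv.2
    rw [toLin'_apply] at hv1
    set a : Fin n → ℝ := fun i => (v i).re with ha
    set b : Fin n → ℝ := fun i => (v i).im with hb
    have hLa : L *ᵥ a = z.re • a - z.im • b := by
      ext i
      have := congrArg Complex.re (congrFun hv1 i)
      simpa [mulVec, dotProduct] using this
    have hLb : L *ᵥ b = z.re • b + z.im • a := by
      ext i
      have := congrArg Complex.im (congrFun hv1 i)
      simpa [mulVec, dotProduct] using this
    have hXt := transpose_eq_of_nonneg hX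
    have hab : b ⬝ᵥ X *ᵥ a = a ⬝ᵥ X *ᵥ b := by
      rw [dotProduct_mulVec, ← mulVec_transpose, hXt, dotProduct_comm]
    have key : ∀ x : Fin n → ℝ, (L *ᵥ x) ⬝ᵥ X *ᵥ (L *ᵥ x) ≤ x ⬝ᵥ X *ᵥ x - x ⬝ᵥ x := by
      intro x
      have h1 := dotProduct_mulVec_mono h x
      rwa [sub_mulVec, one_mulVec, dotProduct_sub, ← mulVec_mulVec, ← mulVec_mulVec,
        dotProduct_mulVec x, vecMul_transpose] at h1
    have ka := key a
    have kb := key b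
    rw [hLa] at ka
    rw [hLb] at kb
    simp only [mulVec_add, mulVec_sub, mulVec_smul, dotProduct_add, dotProduct_sub,
      add_dotProduct, sub_dotProduct, smul_dotProduct, dotProduct_smul, smul_eq_mul, hab] at ka kb
    have hXa := dotProduct_mulVec_mono hX a
    have hXb := dotProduct_mulVec_mono hX b
    simp only [zero_mulVec, dotProduct_zero] at hXa hXb
    have hpos : 0 < a ⬝ᵥ a + b ⬝ᵥ b := by
      have h1 : 0 ≤ a ⬝ᵥ a := by simpa using dotProduct_star_self_nonneg a
      have h2 : 0 ≤ b ⬝ᵥ b := by simpa using dotProduct_star_self_nonneg b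
      refine lt_of_le_of_ne (add_nonneg h1 h2) fun h3 => hv0 ?_
      have h4 : a = 0 := dotProduct_self_eq_zero.1 (by linarith)
      have h5 : b = 0 := dotProduct_self_eq_zero.1 (by linarith)
      ext i
      exact Complex.ext (congrFun h4 i) (congrFun h5 i)
    -- Adding `ka` and `kb` cancels the cross terms: with `V = aᵀXa + bᵀXb ≥ 0`, `|z|² V ≤ V - (|a|²
    -- + |b|²)`, which excludes `|z| ≥ 1`.
    have hz2 : z.re ^ 2 + z.im ^ 2 < 1 := by
      by_contra! hge
      nlinarith
    rw [← NNReal.coe_lt_coe, coe_nnnorm, NNReal.coe_one, ← sq_lt_one_iff₀ (norm_nonneg z),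
      ← Complex.normSq_eq_norm_sq, Complex.normSq_apply]
    linarith

/-- Gelfand's formula gives geometric decay of the complexified powers; taking real parts returns to
`L`. -/
lemma exists_pow_norm_lt {L : Matrix (Fin n) (Fin n) ℝ} (hL : IsStable L) {δ : ℝ} (hδ : 0 < δ) :
    ∃ N, ‖L ^ N‖ < δ := by
  have h1 : Tendsto (fun k => (L.map (algebraMap ℝ ℂ)) ^ k) atTop (𝓝 0) := by
    obtain ⟨r, hr1, hr2⟩ := ENNReal.lt_iff_exists_nnreal_btwn.1 hL
    have hr2' : r < 1 := by exact_mod_cast hr2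
    have h2 := spectrum.pow_nnnorm_pow_one_div_tendsto_nhds_spectralRadius
      (L.map (algebraMap ℝ ℂ))
    rw [tendsto_zero_iff_norm_tendsto_zero]
    refine squeeze_zero' (Eventually.of_forall fun k => norm_nonneg _) ?_
      (tendsto_pow_atTop_nhds_zero_of_lt_one r.coe_nonneg (by exact_mod_cast hr2'))
    filter_upwards [h2.eventually_lt_const hr1, eventually_gt_atTop 0] with k hk hk0
    have hk0' : (0 : ℝ) < k := by exact_mod_cast hk0
    have h3 := ENNReal.rpow_le_rpow hk.le hk0'.le
    rw [← ENNReal.rpow_mul, one_div_mul_cancel hk0'.ne', ENNReal.rpow_one,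
      ENNReal.rpow_natCast] at h3
    exact_mod_cast h3
  have h2 : Tendsto (fun k => L ^ k) atTop (𝓝 0) := by
    have hre : Continuous fun M : Matrix (Fin n) (Fin n) ℂ => M.map Complex.re :=
      continuous_id.matrix_map Complex.continuous_re
    have h3 := (hre.tendsto 0).comp h1
    have h4 : ∀ k, ((L.map (algebraMap ℝ ℂ)) ^ k).map Complex.re = L ^ k := by
      intro k
      rw [← Matrix.map_pow]
      ext i j
      simp
    rw [Matrix.map_zero _ Complex.zero_re] at h3
    exact h3.congr h4
  have h3 := (tendsto_zero_iff_norm_tendsto_zero.1 h2).eventually_lt_const hδ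
  exact h3.exists

/-- Only an inequality is needed, so a finite sum of `(Lᵏ)ᵀLᵏ` replaces the Lyapunov series.
Shifting it loses `1` and gains a tail of at most `1/2`; the factor `2‖Q‖` makes the net loss
dominate `Q`. -/
lemma exists_lyapunov {L : Matrix (Fin n) (Fin n) ℝ} (hL : IsStable L)
    {Q : Matrix (Fin n) (Fin n) ℝ} (hQ : 0 ≤ Q) :
    ∃ X, 0 ≤ X ∧ Lᵀ * X * L + Q ≤ X := by
  obtain ⟨N, hN⟩ := exists_pow_norm_lt hL (δ := 1 / 2) (by norm_num)
  set S : Matrix (Fin n) (Fin n) ℝ := ∑ k ∈ Finset.range N, (L ^ k)ᵀ * L ^ k with hS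
  have hS0 : 0 ≤ S := Finset.sum_nonneg fun k _ => transpose_mul_self_nonneg _
  have hLS : Lᵀ * S * L = S + (L ^ N)ᵀ * L ^ N - 1 := by
    rw [eq_sub_iff_add_eq, hS, ← Finset.sum_range_succ, Finset.sum_range_succ']
    simp [Matrix.mul_sum, Matrix.sum_mul, pow_succ, Matrix.mul_assoc]
  have hLN : (L ^ N)ᵀ * L ^ N ≤ (1 / 2 : ℝ) • 1 := by
    refine (le_norm_smul_one (by simp)).trans (smul_mono_left zero_le_one ?_)
    rw [← conjTranspose_eq_transpose_of_trivial, Matrix.l2_opNorm_conjTranspose_mul_self]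
    nlinarith [norm_nonneg (L ^ N)]
  have hQ1 := le_norm_smul_one (transpose_eq_of_nonneg hQ)
  refine ⟨(2 * ‖Q‖) • S, ?_, ?_⟩
  · simpa using smul_mono_right hS0 (t := 2 * ‖Q‖) (by positivity)
  · rw [Matrix.mul_smul, Matrix.smul_mul, hLS]
    have h1 := smul_mono_right hLN (t := 2 * ‖Q‖) (by positivity)
    calc (2 * ‖Q‖) • (S + (L ^ N)ᵀ * L ^ N - 1) + Q
        = (2 * ‖Q‖) • S + (2 * ‖Q‖) • ((L ^ N)ᵀ * L ^ N) - (2 * ‖Q‖) • 1 + Q := by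
          rw [smul_sub, smul_add]
      _ ≤ (2 * ‖Q‖) • S + (2 * ‖Q‖) • ((1 / 2 : ℝ) • 1) - (2 * ‖Q‖) • 1 + ‖Q‖ • 1 := by
          gcongr
      _ = (2 * ‖Q‖) • S := by module

lemma IsStabilizable.exists_isDARESolution (hRx : 1 ≤ Rx) (h : IsStabilizable A B) :
    ∃ P, IsDARESolution Rx 1 A B P := by
  obtain ⟨K, hK⟩ := h
  have hRx0 : 0 ≤ Rx := zero_le_one.trans hRx
  obtain ⟨X, hX, hle⟩ := exists_lyapunov hK (add_nonneg (transpose_mul_self_nonneg K) hRx0)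
  rw [← add_assoc] at hle
  obtain ⟨P, hP, -⟩ := exists_isDARESolution_le hRx0 hX K hle
  exact ⟨P, hP⟩

lemma isStabilizable_of_costStep_le (hRx : 1 ≤ Rx) (hX : 0 ≤ X) (K : Matrix (Fin m) (Fin n) ℝ)
    (h : costStep Rx A B K X ≤ X) : IsStabilizable A B := by
  refine ⟨K, isStable_of_lyapunov hX ?_⟩
  rw [le_sub_iff_add_le]
  exact (add_le_add (le_add_of_nonneg_right (transpose_mul_self_nonneg K)) hRx).trans h

/-! ### Perturbation of the system. -/

/-- Perturbation of a quadratic form, in the Loewner order. -/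
lemma transpose_mul_mul_add_le (hP : 0 ≤ P) (L D : Matrix (Fin n) (Fin n) ℝ) :
    (L + D)ᵀ * P * (L + D)
      ≤ Lᵀ * P * L + (2 * (‖L‖ * ‖P‖ * ‖D‖) + ‖P‖ * ‖D‖ ^ 2) • 1 := by
  have hPt := transpose_eq_of_nonneg hP
  have h1 : (L + D)ᵀ * P * (L + D)
      = Lᵀ * P * L + (Lᵀ * P * D + (Lᵀ * P * D)ᵀ + Dᵀ * P * D) := by
    simp only [transpose_add, transpose_mul, transpose_transpose, hPt, Matrix.add_mul,
      Matrix.mul_add, Matrix.mul_assoc]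
    abel
  rw [h1]
  refine add_le_add_right ((le_norm_smul_one ?_).trans (smul_mono_left zero_le_one ?_)) _
  · simp only [transpose_add, transpose_mul, transpose_transpose, hPt, Matrix.mul_assoc]
    abel
  · have h2 : ‖Lᵀ * P * D‖ ≤ ‖L‖ * ‖P‖ * ‖D‖ := by
      refine (Matrix.l2_opNorm_mul _ _).trans ?_
      gcongr
      exact (Matrix.l2_opNorm_mul _ _).trans_eq (by rw [norm_transpose_eq])
    have h3 : ‖Dᵀ * P * D‖ ≤ ‖D‖ * ‖P‖ * ‖D‖ := by
      refine (Matrix.l2_opNorm_mul _ _).trans ?_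
      gcongr
      exact (Matrix.l2_opNorm_mul _ _).trans_eq (by rw [norm_transpose_eq])
    calc _ ≤ ‖Lᵀ * P * D‖ + ‖(Lᵀ * P * D)ᵀ‖ + ‖Dᵀ * P * D‖ := norm_add₃_le
      _ ≤ ‖L‖ * ‖P‖ * ‖D‖ + ‖L‖ * ‖P‖ * ‖D‖ + ‖D‖ * ‖P‖ * ‖D‖ := by
        rw [norm_transpose_eq]; gcongr
      _ = _ := by ring

/-- `KᵀK` is one of the nonnegative summands of `P` in the cost identity. -/
lemma IsDARESolution.norm_gain_sq_le (hRx : 1 ≤ Rx) (h : IsDARESolution Rx 1 A B P) :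
    ‖gain A B P‖ ^ 2 ≤ ‖P‖ := by
  refine norm_sq_le_of_transpose_mul_self_le (norm_nonneg P)
    (le_trans ?_ (le_norm_smul_one (transpose_eq_of_nonneg h.nonneg)))
  conv_rhs => rw [← h.costStep_gain]
  exact le_add_of_le_of_nonneg (le_add_of_nonneg_left (transpose_mul_mul_nonneg h.nonneg _))
    (zero_le_one.trans hRx)

/-- Since `1 ≤ P`, `LᵀL ≤ LᵀPL`, a summand of `P` in the cost identity. -/
lemma IsDARESolution.norm_closedLoop_sq_le (hRx : 1 ≤ Rx) (h : IsDARESolution Rx 1 A B P) :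
    ‖A + B * gain A B P‖ ^ 2 ≤ ‖P‖ := by
  refine norm_sq_le_of_transpose_mul_self_le (norm_nonneg P)
    (le_trans ?_ (le_norm_smul_one (transpose_eq_of_nonneg h.nonneg)))
  have h1 := transpose_mul_mul_mono (hRx.trans h.le_self) (A + B * gain A B P)
  rw [Matrix.mul_one] at h1
  refine h1.trans ?_
  conv_rhs => rw [← h.costStep_gain]
  exact le_add_of_le_of_nonneg (le_add_of_nonneg_right (transpose_mul_self_nonneg _))
    (zero_le_one.trans hRx)

lemma IsDARESolution.one_le_norm [NeZero n] (hRx : 1 ≤ Rx) (h : IsDARESolution Rx 1 A B P) :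
    1 ≤ ‖P‖ := by
  have := norm_mono zero_le_one (hRx.trans h.le_self)
  rwa [CStarRing.norm_one] at this

/-- Under a small perturbation of the system, a multiple of the Riccati solution remains a
supersolution of the cost recursion for the unperturbed optimal gain. -/
lemma IsDARESolution.costStep_smul_le (hRx : 1 ≤ Rx) (h : IsDARESolution Rx 1 A B P)
    (hp : 1 ≤ ‖P‖) {A' : Matrix (Fin n) (Fin n) ℝ} {B' : Matrix (Fin n) (Fin m) ℝ}
    {ε : ℝ} (hε : ε * ‖P‖ ^ 2 ≤ 1 / 162) (hA : ‖A' - A‖ ≤ ε) (hB : ‖B' - B‖ ≤ ε) :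
    costStep Rx A' B' (gain A B P) ((1.03 : ℝ) • P) ≤ (1.03 : ℝ) • P := by
  set K := gain A B P with hK
  set L := A + B * K with hL
  set D := (A' - A) + (B' - B) * K with hD
  have hLD : A' + B' * K = L + D := by
    rw [hL, hD, Matrix.sub_mul]; abel
  have hε0 : 0 ≤ ε := (norm_nonneg _).trans hA
  have hs1 : 1 ≤ √‖P‖ := by rwa [Real.one_le_sqrt]
  have hs2 : √‖P‖ ^ 2 = ‖P‖ := Real.sq_sqrt (norm_nonneg P)
  have hKs : ‖K‖ ≤ √‖P‖ := Real.le_sqrt_of_sq_le (h.norm_gain_sq_le hRx)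
  have hLs : ‖L‖ ≤ √‖P‖ := Real.le_sqrt_of_sq_le (h.norm_closedLoop_sq_le hRx)
  have hDs : ‖D‖ ≤ 2 * ε * √‖P‖ := by
    calc ‖D‖ ≤ ‖A' - A‖ + ‖B' - B‖ * ‖K‖ :=
          (norm_add_le _ _).trans (add_le_add_right (Matrix.l2_opNorm_mul _ _) _)
      _ ≤ ε + ε * √‖P‖ := by gcongr
      _ ≤ _ := by nlinarith
  set η := 2 * (‖L‖ * ‖P‖ * ‖D‖) + ‖P‖ * ‖D‖ ^ 2 with hη
  -- Numerically, `4/162 + 4/162² < 0.025`.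
  have hη1 : η ≤ 0.025 := by
    calc η ≤ 2 * (√‖P‖ * ‖P‖ * (2 * ε * √‖P‖)) + ‖P‖ * (2 * ε * √‖P‖) ^ 2 := by
          rw [hη]; gcongr
      _ = 4 * (ε * ‖P‖ ^ 2) + 4 * (ε * (ε * ‖P‖ ^ 2)) := by
          rw [show 2 * (√‖P‖ * ‖P‖ * (2 * ε * √‖P‖)) + ‖P‖ * (2 * ε * √‖P‖) ^ 2
            = 4 * ε * ‖P‖ * √‖P‖ ^ 2 + 4 * ε ^ 2 * ‖P‖ * √‖P‖ ^ 2 by ring, hs2]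
          ring
      _ ≤ 0.025 := by
          have h1 : ε ≤ ε * ‖P‖ ^ 2 := le_mul_of_one_le_right hε0 (one_le_pow₀ hp)
          nlinarith
  have hQ : Lᵀ * P * L = P - (Kᵀ * K + Rx) := by
    rw [eq_sub_iff_add_eq, ← add_assoc]
    exact h.costStep_gain
  have hQ1 : 1 ≤ Kᵀ * K + Rx := le_add_of_nonneg_of_le (transpose_mul_self_nonneg K) hRx
  have hQ0 : 0 ≤ Kᵀ * K + Rx := zero_le_one.trans hQ1
  have h1 : (L + D)ᵀ * P * (L + D) ≤ P - (0.975 : ℝ) • (Kᵀ * K + Rx) := by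
    calc (L + D)ᵀ * P * (L + D) ≤ Lᵀ * P * L + η • 1 := transpose_mul_mul_add_le h.nonneg L D
      _ ≤ P - (Kᵀ * K + Rx) + (0.025 : ℝ) • (Kᵀ * K + Rx) := by
          rw [hQ]
          exact add_le_add_right ((smul_mono_left zero_le_one hη1).trans
            (smul_mono_right hQ1 (by norm_num))) _
      _ = P - (0.975 : ℝ) • (Kᵀ * K + Rx) := by module
  have h2 := smul_mono_right h1 (t := 1.03) (by norm_num)
  rw [costStep, hLD, Matrix.mul_smul, Matrix.smul_mul, add_assoc]
  calc (1.03 : ℝ) • ((L + D)ᵀ * P * (L + D)) + (Kᵀ * K + Rx)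
      ≤ (1.03 : ℝ) • (P - (0.975 : ℝ) • (Kᵀ * K + Rx)) + (1.03 * 0.975 : ℝ) • (Kᵀ * K + Rx) := by
        refine add_le_add h2 ?_
        -- The factor `1.03` is large enough because `1.03 * 0.975 = 1.00425 ≥ 1`.
        have := smul_mono_left hQ0 (s := 1) (t := 1.03 * 0.975) (by norm_num)
        rwa [one_smul] at this
    _ = (1.03 : ℝ) • P := by module

lemma IsDARESolution.of_mem_opBall [NeZero n] (hRx : 1 ≤ Rx) (h : IsDARESolution Rx 1 A B P)
    {A' : Matrix (Fin n) (Fin n) ℝ} {B' : Matrix (Fin n) (Fin m) ℝ}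
    (hmem : (A', B') ∈ opBall (1 / (3 * CSafe Rx 1 A B)) A B) :
    IsStabilizable A' B' ∧
      ∃ P', IsDARESolution Rx 1 A' B' P' ∧ ‖P'‖ ≤ 1.0835 * ‖P‖ := by
  have hp := h.one_le_norm hRx
  obtain ⟨hA, hB⟩ := max_le_iff.1 (show max ‖A' - A‖ ‖B' - B‖ ≤ _ from hmem)
  rw [CSafe, h.pInfty_eq hRx] at hA hB
  have hε : 1 / (3 * (54 * ‖P‖ ^ 5)) * ‖P‖ ^ 2 ≤ 1 / 162 := by
    rw [div_mul_eq_mul_div, div_le_div_iff₀ (by positivity) (by norm_num)]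
    have : ‖P‖ ^ 2 ≤ ‖P‖ ^ 5 := pow_le_pow_right₀ hp (by norm_num)
    linarith
  have hstep := h.costStep_smul_le hRx hp hε hA hB
  have hX : 0 ≤ (1.03 : ℝ) • P := by
    simpa using smul_mono_right h.nonneg (t := 1.03) (by norm_num)
  obtain ⟨P', hP', hle⟩ := exists_isDARESolution_le (zero_le_one.trans hRx) hX _ hstep
  refine ⟨isStabilizable_of_costStep_le hRx hX _ hstep, P', hP', ?_⟩
  have h1 := norm_mono hP'.nonneg hle
  rw [norm_smul, Real.norm_of_nonneg (by norm_num)] at h1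
  linarith

end LQR

/-! ### The main theorem. -/

theorem mainTheorem9 {n m : ℕ} (Rx : Matrix (Fin n) (Fin n) ℝ) (hRx : (Rx - 1).PosSemidef)
    (A₀ : Matrix (Fin n) (Fin n) ℝ) (B₀ : Matrix (Fin n) (Fin m) ℝ)
    (h₀ : LQR.IsStabilizable A₀ B₀)
    (Ahat : Matrix (Fin n) (Fin n) ℝ) (Bhat : Matrix (Fin n) (Fin m) ℝ)
    (hhat : (Ahat, Bhat) ∈ LQR.opBall (1 / (3 * LQR.CSafe Rx 1 A₀ B₀)) A₀ B₀)
    (Astar : Matrix (Fin n) (Fin n) ℝ) (Bstar : Matrix (Fin n) (Fin m) ℝ)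
    (hstar : (Astar, Bstar) ∈ LQR.opBall (1 / (3 * LQR.CSafe Rx 1 A₀ B₀)) A₀ B₀) :
    LQR.IsStabilizable Ahat Bhat ∧ LQR.IsStabilizable Astar Bstar ∧
    (∃! P, LQR.IsDARESolution Rx 1 A₀ B₀ P) ∧
    (∃! P, LQR.IsDARESolution Rx 1 Ahat Bhat P) ∧
    (∃! P, LQR.IsDARESolution Rx 1 Astar Bstar P) ∧
    max ‖Astar - Ahat‖ ‖Bhat - Bstar‖ ≤ 1 / LQR.CSafe Rx 1 Astar Bstar ∧
    ‖LQR.PInfty Rx 1 Astar Bstar‖ ≤ 1.0835 * ‖LQR.PInfty Rx 1 A₀ B₀‖ := by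
  have hRx1 := Matrix.le_iff.2 hRx
  obtain ⟨P, hP⟩ := h₀.exists_isDARESolution hRx1
  rcases Nat.eq_zero_or_pos n with rfl | hn
  -- In dimension zero `1 ≤ ‖P‖` fails, but all systems coincide and both distances are `0`.
  · obtain rfl : Ahat = A₀ := Subsingleton.elim _ _
    obtain rfl : Bhat = B₀ := Subsingleton.elim _ _
    obtain rfl : Astar = Ahat := Subsingleton.elim _ _
    obtain rfl : Bstar = Bhat := Subsingleton.elim _ _
    have hex := hP.existsUnique hRx1
    refine ⟨h₀, h₀, hex, hex, hex, ?_, ?_⟩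
    · rw [sub_self, sub_self, norm_zero, norm_zero, max_self, LQR.CSafe]
      positivity
    · linarith [norm_nonneg (LQR.PInfty Rx 1 Astar Bstar)]
  · have : NeZero n := ⟨hn.ne'⟩
    obtain ⟨hs₁, P₁, hP₁, -⟩ := hP.of_mem_opBall hRx1 hhat
    obtain ⟨hs₂, P₂, hP₂, hle⟩ := hP.of_mem_opBall hRx1 hstar
    refine ⟨hs₁, hs₂, hP.existsUnique hRx1, hP₁.existsUnique hRx1, hP₂.existsUnique hRx1, ?_, ?_⟩
    · obtain ⟨hA₁, hB₁⟩ := max_le_iff.1 (show max ‖Ahat - A₀‖ ‖Bhat - B₀‖ ≤ _ from hhat)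
      obtain ⟨hA₂, hB₂⟩ := max_le_iff.1 (show max ‖Astar - A₀‖ ‖Bstar - B₀‖ ≤ _ from hstar)
      have hp := hP.one_le_norm hRx1
      have hp₂ := hP₂.one_le_norm hRx1
      -- Clearing denominators, this is `2‖P₂‖⁵ ≤ 3‖P‖⁵`.
      have hbound : 2 * (1 / (3 * LQR.CSafe Rx 1 A₀ B₀)) ≤ 1 / LQR.CSafe Rx 1 Astar Bstar := by
        rw [LQR.CSafe, LQR.CSafe, hP.pInfty_eq hRx1, hP₂.pInfty_eq hRx1, mul_one_div,
          div_le_div_iff₀ (by positivity) (by positivity)]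
        have h5 : ‖P₂‖ ^ 5 ≤ (1.0835 * ‖P‖) ^ 5 := by gcongr
        have h6 : (1.0835 : ℝ) ^ 5 ≤ 1.5 := by norm_num
        rw [mul_pow] at h5
        nlinarith [mul_le_mul_of_nonneg_right h6 (by positivity : 0 ≤ ‖P‖ ^ 5)]
      refine max_le ?_ ?_
      · have := norm_sub_le_norm_sub_add_norm_sub Astar A₀ Ahat
        rw [norm_sub_rev A₀ Ahat] at this
        linarith
      · have := norm_sub_le_norm_sub_add_norm_sub Bhat B₀ Bstar
        rw [norm_sub_rev B₀ Bstar] at this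
        linarith
    · rwa [hP₂.pInfty_eq hRx1, hP.pInfty_eq hRx1]
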